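/- For $0<\tau\le L$ and a convex set $\mathcal B\subseteq\mathbb R^n$ with non-empty interior, let $\mathcal F_{\tau,L,\mathcal B}$ be the class of differentiable functions $f$ on $\mathcal B$ that satisfy $f(y)\ge f(x)+\langle\nabla f(x),y-x\rangle+\frac{\tau}{2}\|x-y\|^2$ and $\|\nabla f(x)-\nabla f(y)\|\le L\|x-y\|$ for all $x,y\in\mathcal B$ and attain their minimum over $\mathcal B$ at a point $x_f^*\in\mathcal B$. For $\kappa\ge 1$, $\mu>0$ and $0<\delta_0\le\frac12$, a comparison oracle for $f$ with parameters $(\kappa,\mu,\delta_0)$ answers each query $(x,y)\in\mathcal B\times\mathcal B$ by a random sign $C_f(x,y)\in\{-1,+1\}$, which given $(x,y)$ is independent of the past, such that for all $x,y\in\mathcal B$ $$\mathbb P\bigl(C_f(x,y)=\operatorname{sign}\{f(y)-f(x)\}\bigr)\ \ge\ \tfrac12+\min\bigl\{\delta_0,\ \mu|f(y)-f(x)|^{\kappa-1}\bigr\},$$ where $|\cdot|^{0}=1$ and $\operatorname{sign}(0)$ is fixed to be one of $\pm1$ (the result holds for either choice). For an integer $T$ let $$R_T(\mathcal B)=\inf_{\widehat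 x_T}\ \sup_{f,\,C_f}\ \mathbb E\bigl[f(\widehat x_T)-f(x_f^*)\bigr],$$ where the infimum is over all estimators $\widehat x_T\in\mathcal B$ that use at most $T$ adaptively chosen, possibly randomized, queries to the oracle, and the supremum is over all $f\in\mathcal F_{\tau,L,\mathcal B}$ and all comparison oracles $C_f$ for $f$ with parameters $(\kappa,\mu,\delta_0)$. Theorem. Let $\kappa,\mu,\delta_0,\tau,L$ be as above and $r>0$. (i) If $\kappa=1$, there are constants $c_1,c_2>0$, depending only on $\mu,\delta_0,\tau,L,r$, such that for every $n\ge 8$, every convex $\mathcal B\subseteq\mathbb R^n$ that contains a ball of radius $r$, and all sufficiently large $T$ (depending on $n$, $\mathcal B$ and the parameters), $R_T(\mathcal B)\ge c_1\exp\{-c_2T/n\}$. (ii) If $\kappa>1$ and $\tau<L$, there is a constant $c_3>0$, depending only on $\kappa,\mu,\delta_0,\tau,L,r$, such that for every $n\ge 8$, every convex $\mathcal B\subseteq\mathbb R^n$ that contains a ball of radius $r$, and all sufficiently large $T$ (depending on $n$, $\mathcal B$ and the parameters), $R_T(\mathcal B)\ge c_3\left(\frac nT\right)^{\frac1{2(\kappa-1)}}$.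 -/

import Mathlib

open MeasureTheory ProbabilityTheory
open scoped ENNReal

noncomputable section

/-- `f` belongs to the class of `τ`-strongly convex functions on `B` with `L`-Lipschitz gradient
that attain their minimum in `B`. Only the restriction of `f` to `B` matters; `g` is the gradient
of `f` relative to `B` (which is unique when `B` is convex with non-empty interior). -/
def IsStronglyConvexSmooth {n : ℕ} (τ L : ℝ) (B : Set (EuclideanSpace ℝ (Fin n)))
    (f : EuclideanSpace ℝ (Fin n) → ℝ) : Prop :=
  ∃ g : EuclideanSpace ℝ (Fin n) → EuclideanSpace ℝ (Fin n),
    (∀ x ∈ B, HasGradientWithinAt f (g x) B x) ∧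
    (∀ x ∈ B, ∀ y ∈ B, f x + inner ℝ (g x) (y - x) + τ / 2 * ‖x - y‖ ^ 2 ≤ f y) ∧
    (∀ x ∈ B, ∀ y ∈ B, ‖g x - g y‖ ≤ L * ‖x - y‖) ∧
    (∃ x ∈ B, IsMinOn f B x)

/-- The two-valued sign of a real number: `true` stands for `+1` and `false` for `-1`. Since the
oracle is binary, the sign of `0` has to be one of the two values; `s₀` is the one chosen. -/
def boolSign (s₀ : Bool) (t : ℝ) : Bool :=
  if 0 < t then true else if t < 0 then false else s₀

/-- The Markov kernel `C` (the law of the binary answer to the query `(x, y)`) is a comparison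
oracle for `f` with parameters `(κ, μ, δ₀)`. For `κ = 1` the power is `1`, also at `f x = f y`. -/
def IsComparisonOracle {n : ℕ} (s₀ : Bool) (κ μ δ₀ : ℝ) {B : Set (EuclideanSpace ℝ (Fin n))}
    (f : EuclideanSpace ℝ (Fin n) → ℝ) (C : Kernel (B × B) Bool) : Prop :=
  IsMarkovKernel C ∧
    ∀ x y : B, 1 / 2 + min δ₀ (μ * |f y - f x| ^ (κ - 1)) ≤
      (C (x, y)).real {boolSign s₀ (f y - f x)}

/-- The transcript of `k` rounds: for each round the pair that was queried and the answer. -/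
abbrev Transcript {n : ℕ} (B : Set (EuclideanSpace ℝ (Fin n))) (k : ℕ) : Type :=
  Fin k → (B × B) × Bool

/-- An estimator that makes `T` adaptive and possibly randomized comparison queries:
`query k` is the conditional law of the next query given the transcript of the first `k` rounds
(only `k < T` is used), `estimate` is the conditional law of the output given the full transcript.
A procedure that wants fewer than `T` queries is included: it repeats a query and ignores the
answers. -/
structure Estimator {n : ℕ} (B : Set (EuclideanSpace ℝ (Fin n))) (T : ℕ) where
  query : (k : ℕ) → Kernel (Transcript B k) (B × B)
  query_markov : ∀ k, IsMarkovKernel (query k)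
  estimate : Kernel (Transcript B T) B
  estimate_markov : IsMarkovKernel estimate

/-- The law of one round given the past: a query is drawn, then the oracle's answer is drawn
from `C` at that query, conditionally independently of the past. -/
def Estimator.round {n : ℕ} {B : Set (EuclideanSpace ℝ (Fin n))} {T : ℕ} (A : Estimator B T)
    (C : Kernel (B × B) Bool) (k : ℕ) : Kernel (Transcript B k) ((B × B) × Bool) :=
  (A.query k) ⊗ₖ (Kernel.prodMkLeft (Transcript B k) C)

/-- The law of the transcript of the first `k` rounds of `A` played against the oracle `C`. -/
def Estimator.law {n : ℕ} {B : Set (EuclideanSpace ℝ (Fin n))} {T : ℕ} (A : Estimator B T)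
    (C : Kernel (B × B) Bool) : (k : ℕ) → Measure (Transcript B k)
  | 0 => Measure.dirac Fin.elim0
  | k + 1 => ((A.law C k) ⊗ₘ (A.round C k)).map
      (fun p => (Fin.snoc (α := fun _ => (B × B) × Bool) p.1 p.2 : Transcript B (k + 1)))

/-- The law of the point returned by `A` after its `T` queries to the oracle `C`. -/
def Estimator.outputLaw {n : ℕ} {B : Set (EuclideanSpace ℝ (Fin n))} {T : ℕ}
    (A : Estimator B T) (C : Kernel (B × B) Bool) : Measure B :=
  (A.law C T).bind A.estimate

/-- The expected optimization error `𝔼[f(x̂) - f(x⋆)]` of `A`, for a minimizer `xs` of `f`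
on `B` (the integrand is non-negative, so the expectation always exists in `[0, ∞]`). -/
def Estimator.expectedError {n : ℕ} {B : Set (EuclideanSpace ℝ (Fin n))} {T : ℕ}
    (A : Estimator B T) (C : Kernel (B × B) Bool) (f : EuclideanSpace ℝ (Fin n) → ℝ)
    (xs : EuclideanSpace ℝ (Fin n)) : ℝ≥0∞ :=
  ∫⁻ x : B, ENNReal.ofReal (f x - f xs) ∂(A.outputLaw C)

/-- The minimax risk: infimum over all estimators with `T` queries, supremum over all `f` in the
class (with minimizer `xs`) and all comparison oracles for `f` with the given parameters. -/
def comparisonMinimaxRisk {n : ℕ} (s₀ : Bool) (κ μ δ₀ τ L : ℝ) (B : Set (EuclideanSpace ℝ (Fin n)))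
    (T : ℕ) : ℝ≥0∞ :=
  ⨅ A : Estimator B T,
    ⨆ (f : EuclideanSpace ℝ (Fin n) → ℝ) (_ : IsStronglyConvexSmooth τ L B f)
      (xs : EuclideanSpace ℝ (Fin n)) (_ : xs ∈ B ∧ IsMinOn f B xs)
      (C : Kernel (B × B) Bool) (_ : IsComparisonOracle s₀ κ μ δ₀ f C),
      A.expectedError C f xs

end

/-!
Averaging over a ball of radius `R` gives a point `v` whose `δ`-neighbourhood the output of a given
estimator, played against a reference oracle, hits with probability at most `(δ / R) ^ n`. If the
answers of an oracle for a function with minimizer `v` have second moment density bound `K` with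
respect to the reference, then a probability `P` under the true oracle and `Q` under the reference
satisfy `P ^ 2 ≤ K ^ T * Q`, so the estimator misses `v` by `δ` with probability at least `1 / 2`,
and strong convexity turns the miss into an error of order `τ * δ ^ 2`.

For `κ = 1` the functions are translates of one quadratic and the reference is a fair coin: an
answer is worth at most one bit, `K = 2`. For `κ > 1` they are a fixed quadratic plus a sinusoid of
amplitude `ε`, whose frequency vector moves the minimizer by up to order `√ε` while no increment
changes by more than `2 * ε`. The oracle can then be noiseless, with a sign that does not depend on
the perturbation, wherever the increment of the quadratic exceeds `2 * ε`; elsewhere its bias can be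
as small as `μ * (4 * ε) ^ (κ - 1)`, so `K = 1 + 4 * (μ * (4 * ε) ^ (κ - 1)) ^ 2`, and `ε` is chosen
to make this `1 + n / T`.
-/

noncomputable section

/-- The `χ²`-type closeness of `P` to `Q` used to transfer small probabilities from `Q` to `P`:
if `P` has density `d` with respect to `Q`, the optimal constant `K` is `∫ d² ∂Q`. -/
def SecondMomentBound {α : Type*} [MeasurableSpace α] (P Q : Measure α) (K : ℝ≥0∞) : Prop :=
  ∀ g : α → ℝ≥0∞, Measurable g → (∫⁻ x, g x ∂P) ^ 2 ≤ K * ∫⁻ x, g x ^ 2 ∂Q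

namespace SecondMomentBound

variable {α β : Type*} [MeasurableSpace α] [MeasurableSpace β]

theorem withDensity (Q : Measure α) {d : α → ℝ≥0∞} (hd : Measurable d) :
    SecondMomentBound (Q.withDensity d) Q (∫⁻ x, d x ^ 2 ∂Q) := by
  intro g hg
  have holder := ENNReal.lintegral_mul_le_Lp_mul_Lq Q Real.HolderConjugate.two_two
    hd.aemeasurable hg.aemeasurable
  have sq_sqrt (c : ℝ≥0∞) : (c ^ (1 / 2 : ℝ)) ^ 2 = c := by
    rw [← ENNReal.rpow_mul_natCast]
    norm_num
  simp only [ENNReal.rpow_two] at holder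
  calc (∫⁻ x, g x ∂Q.withDensity d) ^ 2 = (∫⁻ x, (d * g) x ∂Q) ^ 2 := by
        rw [lintegral_withDensity_eq_lintegral_mul Q hd hg]
    _ ≤ ((∫⁻ x, d x ^ 2 ∂Q) ^ (1 / 2 : ℝ) * (∫⁻ x, g x ^ 2 ∂Q) ^ (1 / 2 : ℝ)) ^ 2 := by
        gcongr
    _ = (∫⁻ x, d x ^ 2 ∂Q) * ∫⁻ x, g x ^ 2 ∂Q := by rw [mul_pow, sq_sqrt, sq_sqrt]

theorem refl (P : Measure α) [IsProbabilityMeasure P] : SecondMomentBound P P 1 := by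
  simpa using withDensity P measurable_one

variable {P Q : Measure α} {K K' : ℝ≥0∞}

theorem mono (h : SecondMomentBound P Q K) (hK : K ≤ K') : SecondMomentBound P Q K' :=
  fun g hg => (h g hg).trans (by gcongr)

theorem compProd [SFinite P] [SFinite Q] {κ η : Kernel α β} [IsSFiniteKernel κ]
    [IsSFiniteKernel η] (h : SecondMomentBound P Q K)
    (h' : ∀ a, SecondMomentBound (κ a) (η a) K') :
    SecondMomentBound (P ⊗ₘ κ) (Q ⊗ₘ η) (K * K') := by
  intro g hg
  rw [Measure.lintegral_compProd hg, Measure.lintegral_compProd (hg.pow_const 2)]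
  calc (∫⁻ a, ∫⁻ b, g (a, b) ∂κ a ∂P) ^ 2
      ≤ K * ∫⁻ a, (∫⁻ b, g (a, b) ∂κ a) ^ 2 ∂Q := h _ hg.lintegral_kernel_prod_right'
    _ ≤ K * ∫⁻ a, K' * ∫⁻ b, g (a, b) ^ 2 ∂η a ∂Q := by
      gcongr with a
      exact h' a _ (hg.comp measurable_prodMk_left)
    _ = K * K' * ∫⁻ a, ∫⁻ b, g (a, b) ^ 2 ∂η a ∂Q := by
      rw [lintegral_const_mul _ (hg.pow_const 2).lintegral_kernel_prod_right', mul_assoc]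

theorem map (h : SecondMomentBound P Q K) {u : α → β} (hu : Measurable u) :
    SecondMomentBound (P.map u) (Q.map u) K := by
  intro g hg
  rw [lintegral_map hg hu, lintegral_map (hg.pow_const 2) hu]
  exact h _ (hg.comp hu)

theorem bind (h : SecondMomentBound P Q K) [SFinite P] [SFinite Q] (κ : Kernel α β)
    [IsMarkovKernel κ] : SecondMomentBound (P.bind κ) (Q.bind κ) K := by
  have := (h.compProd fun a => refl (κ a)).map measurable_snd
  rwa [mul_one, ← Measure.snd, ← Measure.snd, Measure.snd_compProd, Measure.snd_compProd] at this

theorem measure_sq_le (h : SecondMomentBound P Q K) {s : Set α} (hs : MeasurableSet s) :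
    P s ^ 2 ≤ K * Q s := by
  have indicator_sq : (fun x => s.indicator (1 : α → ℝ≥0∞) x ^ 2) = s.indicator 1 := by
    ext x
    by_cases hx : x ∈ s <;> simp [hx]
  simpa only [indicator_sq, lintegral_indicator_one hs] using
    h (s.indicator 1) (measurable_one.indicator hs)

theorem half_le_measure_compl (h : SecondMomentBound P Q K) [IsProbabilityMeasure P] {s : Set α}
    (hs : MeasurableSet s) (hK : K * Q s ≤ 1 / 4) : 1 / 2 ≤ P sᶜ := by
  have hsq : P s ^ 2 ≤ (1 / 2) ^ 2 := by
    refine (h.measure_sq_le hs).trans (hK.trans_eq ?_)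
    simp only [one_div, ← ENNReal.inv_pow]
    norm_num
  have hle : P s ≤ 1 / 2 := (ENNReal.pow_le_pow_left_iff two_ne_zero).1 hsq
  calc (1 / 2 : ℝ≥0∞) = 1 - 1 / 2 := by simp
    _ ≤ 1 - P s := tsub_le_tsub_left hle 1
    _ = P sᶜ := (prob_compl_eq_one_sub hs).symm

end SecondMomentBound

theorem measurable_fin_snoc {α : Type*} [MeasurableSpace α] (k : ℕ) : Measurable
    (fun p : (Fin k → α) × α => (Fin.snoc (α := fun _ => α) p.1 p.2 : Fin (k + 1) → α)) := by
  refine measurable_pi_iff.2 (Fin.lastCases ?_ fun i => ?_)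
  · simpa using measurable_snd
  · simp only [Fin.snoc_castSucc]
    fun_prop

namespace Estimator

variable {n T : ℕ} {B : Set (EuclideanSpace ℝ (Fin n))} (A : Estimator B T)

instance (k : ℕ) : IsMarkovKernel (A.query k) := A.query_markov k

instance : IsMarkovKernel A.estimate := A.estimate_markov

variable (C Q : Kernel (B × B) Bool) [IsMarkovKernel C] [IsMarkovKernel Q]

instance (k : ℕ) : IsMarkovKernel (A.round C k) := by
  unfold Estimator.round
  infer_instance

instance (k : ℕ) : IsProbabilityMeasure (A.law C k) := by
  induction k with
  | zero => exact Measure.dirac.isProbabilityMeasure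
  | succ k ih => exact Measure.isProbabilityMeasure_map (measurable_fin_snoc k).aemeasurable

instance : IsProbabilityMeasure (A.outputLaw C) := by
  unfold Estimator.outputLaw
  infer_instance

variable {C Q} {K : ℝ≥0∞}

theorem secondMomentBound_round (h : ∀ z, SecondMomentBound (C z) (Q z) K) (k : ℕ)
    (p : Transcript B k) : SecondMomentBound (A.round C k p) (A.round Q k p) K := by
  unfold Estimator.round
  rw [Kernel.compProd_apply_eq_compProd_sectR, Kernel.compProd_apply_eq_compProd_sectR,
    ← one_mul K]
  refine (SecondMomentBound.refl _).compProd fun z => ?_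
  simpa only [Kernel.sectR_apply, Kernel.prodMkLeft_apply] using h z

theorem secondMomentBound_law (h : ∀ z, SecondMomentBound (C z) (Q z) K) (k : ℕ) :
    SecondMomentBound (A.law C k) (A.law Q k) (K ^ k) := by
  induction k with
  | zero => exact pow_zero K ▸ SecondMomentBound.refl (A.law C 0)
  | succ k ih =>
    rw [pow_succ]
    exact (ih.compProd (A.secondMomentBound_round h k)).map (measurable_fin_snoc k)

theorem secondMomentBound_outputLaw (h : ∀ z, SecondMomentBound (C z) (Q z) K) :
    SecondMomentBound (A.outputLaw C) (A.outputLaw Q) (K ^ T) :=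
  (A.secondMomentBound_law h T).bind A.estimate

end Estimator

section Packing

variable {E : Type*} [NormedAddCommGroup E] [NormedSpace ℝ E] [FiniteDimensional ℝ E]
  [MeasurableSpace E] [BorelSpace E]

theorem measurableSet_dist_lt (δ : ℝ) : MeasurableSet {p : E × E | dist p.2 p.1 < δ} :=
  measurableSet_lt (by fun_prop) measurable_const

theorem lintegral_measure_ball (P ν : Measure E) [SFinite P] [ν.IsAddHaarMeasure] (δ : ℝ) :
    ∫⁻ v, P (Metric.ball v δ) ∂ν = ν (Metric.ball 0 δ) * P Set.univ := by
  calc ∫⁻ v, P (Metric.ball v δ) ∂ν = ∫⁻ x, ν (Metric.ball x δ) ∂P := by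
        have fubini := (Measure.prod_apply (μ := ν) (ν := P) (measurableSet_dist_lt δ)).symm.trans
          (Measure.prod_apply_symm (measurableSet_dist_lt δ))
        simpa only [Metric.ball, Set.preimage_ofPred_eq, dist_comm] using fubini
    _ = ν (Metric.ball 0 δ) * P Set.univ := by
        simp only [Measure.addHaar_ball_center, lintegral_const]

theorem exists_measure_ball_le (P : Measure E) [IsProbabilityMeasure P] (x₀ : E) {R δ : ℝ}
    (hR : 0 < R) (hδ : 0 < δ) :
    ∃ v ∈ Metric.ball x₀ R,
      P (Metric.ball v δ) ≤ ENNReal.ofReal ((δ / R) ^ Module.finrank ℝ E) := by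
  let ν : Measure E := Measure.addHaar
  have hmeas : Measurable fun v => P (Metric.ball v δ) :=
    measurable_measure_prodMk_left (measurableSet_dist_lt δ)
  obtain ⟨v, hv, hle⟩ := exists_le_setLAverage (μ := ν) (s := Metric.ball x₀ R)
    (Metric.measure_ball_pos _ _ hR).ne' measure_ball_lt_top.ne hmeas.aemeasurable
  refine ⟨v, hv, hle.trans ?_⟩
  rw [setLAverage_eq]
  refine ENNReal.div_le_of_le_mul ?_
  calc ∫⁻ v in Metric.ball x₀ R, P (Metric.ball v δ) ∂ν
      ≤ ∫⁻ v, P (Metric.ball v δ) ∂ν := setLIntegral_le_lintegral _ _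
    _ = ν (Metric.ball 0 δ) := by rw [lintegral_measure_ball, measure_univ, mul_one]
    _ = ENNReal.ofReal ((δ / R) ^ Module.finrank ℝ E) * ν (Metric.ball x₀ R) := by
      rw [Measure.addHaar_ball_of_pos ν _ hδ, Measure.addHaar_ball_of_pos ν _ hR, ← mul_assoc,
        ← ENNReal.ofReal_mul (by positivity), div_pow, div_mul_cancel₀ _ (by positivity)]

end Packing

section Reduction

variable {n T : ℕ} {B : Set (EuclideanSpace ℝ (Fin n))}

theorem Estimator.mul_outputLaw_le_expectedError (A : Estimator B T) (C : Kernel (B × B) Bool)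
    {f : EuclideanSpace ℝ (Fin n) → ℝ} {v : EuclideanSpace ℝ (Fin n)} {τ δ : ℝ} (hτ : 0 ≤ τ)
    (hδ : 0 ≤ δ) (hgrowth : ∀ x ∈ B, f v + τ / 2 * ‖x - v‖ ^ 2 ≤ f x) :
    ENNReal.ofReal (τ / 2 * δ ^ 2) * A.outputLaw C (Subtype.val ⁻¹' Metric.ball v δ)ᶜ ≤
      A.expectedError C f v := by
  rw [← setLIntegral_const]
  refine (setLIntegral_mono_ae' ?_ ?_).trans (setLIntegral_le_lintegral _ _)
  · exact (measurable_subtype_coe Metric.isOpen_ball.measurableSet).compl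
  refine .of_forall fun x hx => ENNReal.ofReal_le_ofReal (le_sub_iff_add_le'.2 ?_)
  have hdist : δ ≤ ‖(x : EuclideanSpace ℝ (Fin n)) - v‖ := by
    simpa [dist_eq_norm] using hx
  refine le_trans ?_ (hgrowth x x.2)
  gcongr

theorem IsStronglyConvexSmooth.growth {τ L : ℝ} {f : EuclideanSpace ℝ (Fin n) → ℝ}
    (hf : IsStronglyConvexSmooth τ L B f) {v : EuclideanSpace ℝ (Fin n)} (hv : v ∈ interior B)
    (hmin : IsMinOn f B v) : ∀ x ∈ B, f v + τ / 2 * ‖x - v‖ ^ 2 ≤ f x := by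
  intro x hx
  obtain ⟨g, hg, hconvex, -, -⟩ := hf
  have hB : B ∈ nhds v := mem_interior_iff_mem_nhds.1 hv
  have hgv : g v = 0 := by
    have hderiv := (hg v (interior_subset hv)).hasFDerivWithinAt.hasFDerivAt hB
    simpa using (hmin.isLocalMin hB).hasFDerivAt_eq_zero hderiv
  simpa [hgv, norm_sub_rev v x] using hconvex v (interior_subset hv) x hx

theorem Estimator.expectedError_le_iSup (A : Estimator B T) {s₀ : Bool} {κ μ δ₀ τ L : ℝ}
    {f : EuclideanSpace ℝ (Fin n) → ℝ} (hf : IsStronglyConvexSmooth τ L B f)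
    {v : EuclideanSpace ℝ (Fin n)} (hv : v ∈ B ∧ IsMinOn f B v) {C : Kernel (B × B) Bool}
    (hC : IsComparisonOracle s₀ κ μ δ₀ f C) :
    A.expectedError C f v ≤ ⨆ (f) (_ : IsStronglyConvexSmooth τ L B f) (xs)
      (_ : xs ∈ B ∧ IsMinOn f B xs) (C) (_ : IsComparisonOracle s₀ κ μ δ₀ f C),
        A.expectedError C f xs :=
  le_iSup₂_of_le f hf (le_iSup₂_of_le v hv (le_iSup₂_of_le C hC le_rfl))

theorem le_comparisonMinimaxRisk_of_forall_mem_ball {s₀ : Bool} {κ μ δ₀ τ L : ℝ} (hτ : 0 ≤ τ)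
    {x₀ : EuclideanSpace ℝ (Fin n)} {R δ K : ℝ} (hR : 0 < R) (hδ : 0 < δ) (hK : 0 ≤ K)
    (hball : Metric.ball x₀ R ⊆ B) (Q : Kernel (B × B) Bool) [IsMarkovKernel Q]
    (hfamily : ∀ v ∈ Metric.ball x₀ R, ∃ f, IsStronglyConvexSmooth τ L B f ∧ IsMinOn f B v ∧
      ∃ C, IsComparisonOracle s₀ κ μ δ₀ f C ∧
        ∀ z, SecondMomentBound (C z) (Q z) (ENNReal.ofReal K))
    (hKδ : K ^ T * (δ / R) ^ n ≤ 1 / 4) :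
    ENNReal.ofReal (τ / 4 * δ ^ 2) ≤ comparisonMinimaxRisk s₀ κ μ δ₀ τ L B T := by
  refine le_iInf fun A => ?_
  have hval : Measurable (Subtype.val : B → EuclideanSpace ℝ (Fin n)) := measurable_subtype_coe
  have := Measure.isProbabilityMeasure_map (μ := A.outputLaw Q) hval.aemeasurable
  obtain ⟨v, hv, hQv⟩ := exists_measure_ball_le ((A.outputLaw Q).map Subtype.val) x₀ hR hδ
  rw [Measure.map_apply hval Metric.isOpen_ball.measurableSet, finrank_euclideanSpace_fin] at hQv
  obtain ⟨f, hf, hmin, C, hC, hCQ⟩ := hfamily v hv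
  have := hC.1
  have hmiss : 1 / 2 ≤ A.outputLaw C (Subtype.val ⁻¹' Metric.ball v δ)ᶜ := by
    refine (A.secondMomentBound_outputLaw hCQ).half_le_measure_compl
      (hval Metric.isOpen_ball.measurableSet) ?_
    calc ENNReal.ofReal K ^ T * A.outputLaw Q (Subtype.val ⁻¹' Metric.ball v δ)
        ≤ ENNReal.ofReal K ^ T * ENNReal.ofReal ((δ / R) ^ n) := by gcongr
      _ = ENNReal.ofReal (K ^ T * (δ / R) ^ n) := by
        rw [ENNReal.ofReal_mul (by positivity), ENNReal.ofReal_pow hK]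
      _ ≤ ENNReal.ofReal (1 / 4) := ENNReal.ofReal_le_ofReal hKδ
      _ = 1 / 4 := by simp [ENNReal.ofReal_inv_of_pos]
  calc ENNReal.ofReal (τ / 4 * δ ^ 2) = ENNReal.ofReal (τ / 2 * δ ^ 2) * (1 / 2) := by
        rw [show τ / 4 * δ ^ 2 = τ / 2 * δ ^ 2 * (1 / 2) by ring,
          ENNReal.ofReal_mul (by positivity)]
        simp [ENNReal.ofReal_inv_of_pos]
    _ ≤ ENNReal.ofReal (τ / 2 * δ ^ 2) *
          A.outputLaw C (Subtype.val ⁻¹' Metric.ball v δ)ᶜ := by gcongr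
    _ ≤ A.expectedError C f v := A.mul_outputLaw_le_expectedError C hτ hδ.le
        (hf.growth (interior_maximal hball Metric.isOpen_ball hv) hmin)
    _ ≤ _ := A.expectedError_le_iSup hf ⟨hball hv, hmin⟩ hC

end Reduction

section Oracles

theorem lintegral_bernoulliMeasure {X : Type*} [MeasurableSpace X] [MeasurableSingletonClass X]
    (x y : X) (p : unitInterval) (g : X → ℝ≥0∞) :
    ∫⁻ t, g t ∂bernoulliMeasure x y p =
      ENNReal.ofReal p * g x + ENNReal.ofReal (1 - p) * g y := by
  have coe_toNNReal (q : unitInterval) : (unitInterval.toNNReal q : ℝ≥0∞) = ENNReal.ofReal q := by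
    rw [ENNReal.ofReal, Real.toNNReal_of_nonneg q.2.1]
    rfl
  rw [bernoulliMeasure_def, lintegral_add_measure, lintegral_smul_measure, lintegral_smul_measure,
    lintegral_dirac, lintegral_dirac, ENNReal.smul_def, ENNReal.smul_def, coe_toNNReal,
    coe_toNNReal, unitInterval.coe_symm_eq, smul_eq_mul, smul_eq_mul]

/-- The law of a fair binary answer. -/
def fairCoin : Measure Bool := bernoulliMeasure true false ⟨1 / 2, by norm_num⟩

instance : IsProbabilityMeasure fairCoin := by
  unfold fairCoin
  infer_instance

theorem lintegral_fairCoin (g : Bool → ℝ≥0∞) (s : Bool) :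
    ∫⁻ t, g t ∂fairCoin = ENNReal.ofReal (1 / 2) * (g s + g !s) := by
  have half : (1 - 1 / 2 : ℝ) = 1 / 2 := by norm_num
  rw [fairCoin, lintegral_bernoulliMeasure, half, ← mul_add]
  cases s
  · rw [add_comm, Bool.not_false]
  · rw [Bool.not_true]

/-- The binary symmetric channel that transmits a bit correctly with probability `p`; it models
the noise of a comparison oracle. -/
def symmetricChannel (p : unitInterval) : Kernel Bool Bool :=
  Kernel.ofFunOfCountable fun s => bernoulliMeasure s (!s) p

theorem symmetricChannel_apply (p : unitInterval) (s : Bool) :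
    symmetricChannel p s = bernoulliMeasure s (!s) p := rfl

instance (p : unitInterval) : IsMarkovKernel (symmetricChannel p) :=
  ⟨fun s => by rw [symmetricChannel_apply]; infer_instance⟩

theorem symmetricChannel_eq_withDensity (p : unitInterval) (s : Bool) :
    symmetricChannel p s = fairCoin.withDensity fun t =>
      ENNReal.ofReal (2 * if t = s then (p : ℝ) else 1 - p) := by
  have half_mul (c : ℝ) (x : ℝ≥0∞) :
      ENNReal.ofReal (1 / 2) * (ENNReal.ofReal (2 * c) * x) = ENNReal.ofReal c * x := by
    rw [← mul_assoc, ← ENNReal.ofReal_mul (by norm_num), one_div, inv_mul_cancel_left₀ two_ne_zero]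
  refine Measure.ext_of_lintegral _ fun g hg => ?_
  rw [symmetricChannel_apply, lintegral_bernoulliMeasure,
    lintegral_withDensity_eq_lintegral_mul _ (measurable_of_countable _) hg,
    lintegral_fairCoin _ s, mul_add]
  simp only [Pi.mul_apply, half_mul, if_true, Bool.not_eq_self, if_false]

theorem secondMomentBound_symmetricChannel (p : unitInterval) (s : Bool) :
    SecondMomentBound (symmetricChannel p s) fairCoin
      (ENNReal.ofReal (2 * (p ^ 2 + (1 - p) ^ 2))) := by
  have hp : (0 : ℝ) ≤ 1 - p := sub_nonneg.2 p.2.2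
  rw [symmetricChannel_eq_withDensity]
  refine (SecondMomentBound.withDensity _ (measurable_of_countable _)).mono (le_of_eq ?_)
  rw [lintegral_fairCoin _ s]
  simp only [if_true, Bool.not_eq_self, if_false]
  rw [← ENNReal.ofReal_pow (mul_nonneg zero_le_two p.2.1), ← ENNReal.ofReal_pow (by positivity),
    ← ENNReal.ofReal_add (by positivity) (by positivity), ← ENNReal.ofReal_mul (by positivity)]
  ring_nf

theorem measurable_boolSign (s₀ : Bool) : Measurable (boolSign s₀) :=
  Measurable.ite measurableSet_Ioi measurable_const
    (Measurable.ite measurableSet_Iio measurable_const measurable_const)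

theorem boolSign_eq_of_abs_sub_lt {s₀ : Bool} {s t : ℝ} (h : |s - t| < |t|) :
    boolSign s₀ s = boolSign s₀ t := by
  unfold boolSign
  rcases le_total 0 t with ht | ht
  · rw [abs_of_nonneg ht, abs_lt] at h
    rw [if_pos (by linarith), if_pos (by linarith)]
  · rw [abs_of_nonpos ht, abs_lt] at h
    rw [if_neg (by linarith), if_pos (by linarith), if_neg (by linarith), if_pos (by linarith)]

variable {n : ℕ} {B : Set (EuclideanSpace ℝ (Fin n))} {f q : EuclideanSpace ℝ (Fin n) → ℝ}

/-- The oracle that reports the sign of the increment of `f` correctly with probability `p`. -/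
def signOracle (s₀ : Bool) (p : unitInterval) (hf : Measurable f) : Kernel (B × B) Bool :=
  (symmetricChannel p).comap (fun z => boolSign s₀ (f z.2 - f z.1))
    ((measurable_boolSign s₀).comp (by fun_prop))

instance (s₀ : Bool) (p : unitInterval) (hf : Measurable f) :
    IsMarkovKernel (signOracle (B := B) s₀ p hf) := by
  unfold signOracle
  infer_instance

theorem signOracle_apply (s₀ : Bool) (p : unitInterval) (hf : Measurable f) (z : B × B) :
    signOracle s₀ p hf z = symmetricChannel p (boolSign s₀ (f z.2 - f z.1)) := rfl

theorem signOracle_real_singleton (s₀ : Bool) (p : unitInterval) (hf : Measurable f)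
    (x y : B) : (signOracle s₀ p hf (x, y)).real {boolSign s₀ (f y - f x)} = p := by
  rw [signOracle_apply, symmetricChannel_apply]
  exact bernoulliMeasure_real_apply_of_mem_of_notMem _ (measurableSet_singleton _) rfl (by simp)

theorem isComparisonOracle_signOracle_one (s₀ : Bool) {κ μ δ₀ : ℝ} (hδ₀ : δ₀ ≤ 1 / 2)
    (hf : Measurable f) : IsComparisonOracle s₀ κ μ δ₀ f (signOracle (B := B) s₀ 1 hf) := by
  refine ⟨inferInstance, fun x y => ?_⟩
  rw [signOracle_real_singleton, Set.Icc.coe_one]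
  linarith [min_le_left δ₀ (μ * |f y - f x| ^ (κ - 1))]

theorem measurableSet_lt_abs_increment (hq : Measurable q) (θ : ℝ) :
    MeasurableSet {z : B × B | θ < |q z.2 - q z.1|} := by
  simp only [← Real.norm_eq_abs]
  exact measurableSet_lt measurable_const (by fun_prop)

/-- The oracle for `f` that is perfect on queries where the increment of `q` exceeds `θ`, and
correct with probability `p` on the others. -/
def thresholdOracle (s₀ : Bool) (p : unitInterval) (θ : ℝ) (hq : Measurable q)
    (hf : Measurable f) : Kernel (B × B) Bool :=
  Kernel.piecewise (measurableSet_lt_abs_increment hq θ) (signOracle s₀ 1 hf) (signOracle s₀ p hf)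

/-- The common reference for the oracles `thresholdOracle s₀ p θ hq hf`, as `f` varies: below the
threshold its answers carry no information. -/
def referenceOracle (s₀ : Bool) (θ : ℝ) (hq : Measurable q) : Kernel (B × B) Bool :=
  Kernel.piecewise (measurableSet_lt_abs_increment hq θ) (signOracle s₀ 1 hq)
    (Kernel.const _ fairCoin)

instance (s₀ : Bool) (θ : ℝ) (hq : Measurable q) :
    IsMarkovKernel (referenceOracle (B := B) s₀ θ hq) := by
  unfold referenceOracle
  infer_instance

theorem isComparisonOracle_thresholdOracle (s₀ : Bool) {κ μ δ₀ θ : ℝ} {p : unitInterval}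
    (hδ₀ : δ₀ ≤ 1 / 2) (hq : Measurable q) (hf : Measurable f)
    (hp : ∀ x y : B, |q y - q x| ≤ θ → 1 / 2 + min δ₀ (μ * |f y - f x| ^ (κ - 1)) ≤ p) :
    IsComparisonOracle s₀ κ μ δ₀ f (thresholdOracle (B := B) s₀ p θ hq hf) := by
  refine ⟨by unfold thresholdOracle; infer_instance, fun x y => ?_⟩
  rw [thresholdOracle, Kernel.piecewise_apply]
  split_ifs with hfar
  · exact (isComparisonOracle_signOracle_one s₀ hδ₀ hf).2 x y
  · rw [signOracle_real_singleton]
    exact hp x y (not_lt.1 hfar)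

theorem secondMomentBound_thresholdOracle (s₀ : Bool) {θ : ℝ} (p : unitInterval)
    (hq : Measurable q) (hf : Measurable f)
    (hfq : ∀ x y : B, |(f y - f x) - (q y - q x)| ≤ θ) (z : B × B) :
    SecondMomentBound (thresholdOracle s₀ p θ hq hf z) (referenceOracle s₀ θ hq z)
      (ENNReal.ofReal (2 * (p ^ 2 + (1 - p) ^ 2))) := by
  rw [thresholdOracle, referenceOracle, Kernel.piecewise_apply, Kernel.piecewise_apply]
  split_ifs with hfar
  · rw [signOracle_apply, signOracle_apply,
      boolSign_eq_of_abs_sub_lt ((hfq z.1 z.2).trans_lt hfar)]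
    refine (SecondMomentBound.refl _).mono (ENNReal.one_le_ofReal.2 ?_)
    linarith [sq_nonneg (2 * (p : ℝ) - 1)]
  · exact secondMomentBound_symmetricChannel p _

theorem exists_referenceOracle (s₀ : Bool) {κ μ δ₀ θ : ℝ} (hκ : 1 ≤ κ) (hμ : 0 ≤ μ)
    (hδ₀ : δ₀ ≤ 1 / 2) (hθ : 0 ≤ θ) (hq : Measurable q) :
    ∃ Q : Kernel (B × B) Bool, IsMarkovKernel Q ∧
      ∀ f : EuclideanSpace ℝ (Fin n) → ℝ, Measurable f →
        (∀ x y : B, |(f y - f x) - (q y - q x)| ≤ θ) →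
        ∃ C, IsComparisonOracle s₀ κ μ δ₀ f C ∧ ∀ z, SecondMomentBound (C z) (Q z)
          (ENNReal.ofReal (1 + 4 * (μ * (2 * θ) ^ (κ - 1)) ^ 2)) := by
  let b : ℝ := min (1 / 2) (μ * (2 * θ) ^ (κ - 1))
  have hb : 0 ≤ b := by positivity
  have hb_half : b ≤ 1 / 2 := min_le_left _ _
  have hbμ : b ≤ μ * (2 * θ) ^ (κ - 1) := min_le_right _ _
  let p : unitInterval := ⟨1 / 2 + b, add_nonneg (by norm_num) hb, by linarith⟩
  refine ⟨referenceOracle s₀ θ hq, inferInstance, fun f hf hfq =>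
    ⟨thresholdOracle s₀ p θ hq hf, ?_, fun z => ?_⟩⟩
  · refine isComparisonOracle_thresholdOracle s₀ hδ₀ hq hf fun x y hnear => ?_
    have hincr : |f y - f x| ≤ 2 * θ := by
      linarith [abs_sub_abs_le_abs_sub (f y - f x) (q y - q x), hfq x y]
    refine add_le_add_right (min_le_min hδ₀ ?_) _
    gcongr
  · refine (secondMomentBound_thresholdOracle s₀ p hq hf hfq z).mono (ENNReal.ofReal_le_ofReal ?_)
    calc 2 * ((1 / 2 + b) ^ 2 + (1 - (1 / 2 + b)) ^ 2) = 1 + 4 * b ^ 2 := by ring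
      _ ≤ 1 + 4 * (μ * (2 * θ) ^ (κ - 1)) ^ 2 := by gcongr

end Oracles

section SinQuadratic

theorem sin_le_sin_add_cos_mul_sub (s t : ℝ) :
    Real.sin t ≤ Real.sin s + Real.cos s * (t - s) + (t - s) ^ 2 / 2 := by
  let φ (x : ℝ) : ℝ := x ^ 2 / 2 - Real.sin x - (s - Real.cos s) * x
  have hderiv (x : ℝ) : HasDerivAt φ (x - Real.cos x - (s - Real.cos s)) x := by
    refine ((((hasDerivAt_pow 2 x).div_const 2).sub (Real.hasDerivAt_sin x)).sub
      ((hasDerivAt_id x).const_mul (s - Real.cos s))).congr_deriv ?_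
    norm_num
  have hmono : Monotone (deriv φ) := by
    intro x y hxy
    rw [(hderiv x).deriv, (hderiv y).deriv]
    have hcos := (le_abs_self _).trans (Real.abs_cos_sub_cos_le y x)
    rw [abs_of_nonneg (sub_nonneg.2 hxy)] at hcos
    linarith
  have hconvex : ConvexOn ℝ Set.univ φ :=
    hmono.convexOn_univ_of_deriv fun x => (hderiv x).differentiableAt
  have hmin : IsMinOn φ Set.univ s := by
    refine hconvex.isMinOn_of_rightDeriv_eq_zero (by simp) ?_
    rw [(hderiv s).hasDerivWithinAt.derivWithin (uniqueDiffWithinAt_Ioi s), sub_self]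
  have hle : φ s ≤ φ t := hmin (Set.mem_univ t)
  dsimp only [φ] at hle
  linarith

variable {E : Type*} [NormedAddCommGroup E] [InnerProductSpace ℝ E]

/-- The phase of the perturbation in `sinQuadratic`, which vanishes at the point `x₀ + u`. -/
def sinPhase (a ε : ℝ) (x₀ u x : E) : ℝ := a / ε * inner ℝ u (x - x₀ - u)

/-- The quadratic `a / 2 * ‖x - x₀‖ ^ 2` with a sinusoidal perturbation of amplitude `ε`, scaled so
that the minimizer moves from `x₀` to `x₀ + u`. -/
def sinQuadratic (a ε : ℝ) (x₀ u x : E) : ℝ :=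
  a / 2 * ‖x - x₀‖ ^ 2 - ε * Real.sin (sinPhase a ε x₀ u x)

/-- The gradient of `sinQuadratic a ε x₀ u` at `x`. -/
def sinQuadraticGrad (a ε : ℝ) (x₀ u x : E) : E :=
  a • (x - x₀) - (a * Real.cos (sinPhase a ε x₀ u x)) • u

theorem sinPhase_sub (a ε : ℝ) (x₀ u x y : E) :
    sinPhase a ε x₀ u y - sinPhase a ε x₀ u x = a / ε * inner ℝ u (y - x) := by
  simp only [sinPhase, inner_sub_right]
  ring

theorem continuous_sinQuadratic (a ε : ℝ) (x₀ u : E) : Continuous (sinQuadratic a ε x₀ u) := by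
  unfold sinQuadratic sinPhase
  fun_prop

theorem hasGradientAt_sinQuadratic [CompleteSpace E] (a : ℝ) {ε : ℝ} (hε : ε ≠ 0) (x₀ u x : E) :
    HasGradientAt (sinQuadratic a ε x₀ u) (sinQuadraticGrad a ε x₀ u x) x := by
  have hsub : HasFDerivAt (fun x : E => x - x₀) (ContinuousLinearMap.id ℝ E) x :=
    (hasFDerivAt_id x).sub_const x₀
  have hphase : HasFDerivAt (sinPhase a ε x₀ u) ((a / ε) • innerSL ℝ u) x :=
    ((innerSL ℝ u).hasFDerivAt.comp x (hsub.sub_const u)).const_mul (a / ε)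
  refine hasGradientAt_iff_hasFDerivAt.2
    (((hsub.norm_sq.const_mul (a / 2)).sub (hphase.sin.const_mul ε)).congr_fderiv ?_)
  ext y
  simp only [sinQuadraticGrad, map_sub, map_smul, sub_apply, smul_apply, smul_eq_mul,
    nsmul_eq_mul, Nat.cast_ofNat, ContinuousLinearMap.comp_id, coe_innerSL_apply,
    InnerProductSpace.toDual_apply_apply]
  field_simp

theorem sinQuadraticGrad_add (a ε : ℝ) (x₀ u : E) : sinQuadraticGrad a ε x₀ u (x₀ + u) = 0 := by
  simp [sinQuadraticGrad, sinPhase]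

theorem sinQuadratic_lower {a ε τ : ℝ} (hε : 0 < ε) {u : E}
    (hu : a ^ 2 * ‖u‖ ^ 2 ≤ ε * (a - τ)) (x₀ x y : E) :
    sinQuadratic a ε x₀ u x + inner ℝ (sinQuadraticGrad a ε x₀ u x) (y - x)
      + τ / 2 * ‖x - y‖ ^ 2 ≤ sinQuadratic a ε x₀ u y := by
  have hsin := sin_le_sin_add_cos_mul_sub (sinPhase a ε x₀ u x) (sinPhase a ε x₀ u y)
  have hquad : ‖y - x₀‖ ^ 2 = ‖x - x₀‖ ^ 2 + 2 * inner ℝ (x - x₀) (y - x) + ‖x - y‖ ^ 2 := by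
    rw [norm_sub_rev x y, ← norm_add_sq_real, sub_add_sub_cancel']
  have hphase : ε * (sinPhase a ε x₀ u y - sinPhase a ε x₀ u x) ^ 2 ≤ (a - τ) * ‖x - y‖ ^ 2 := by
    calc ε * (sinPhase a ε x₀ u y - sinPhase a ε x₀ u x) ^ 2
        = a ^ 2 / ε * inner ℝ u (y - x) ^ 2 := by
          rw [sinPhase_sub]
          field_simp
      _ ≤ a ^ 2 / ε * (‖u‖ * ‖x - y‖) ^ 2 := by
          rw [norm_sub_rev x y]
          gcongr ?_ * ?_
          exact sq_le_sq' (neg_le_of_abs_le (abs_real_inner_le_norm _ _)) (real_inner_le_norm _ _)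
      _ = a ^ 2 * ‖u‖ ^ 2 / ε * ‖x - y‖ ^ 2 := by ring
      _ ≤ (a - τ) * ‖x - y‖ ^ 2 := by
          gcongr
          rwa [div_le_iff₀' hε]
  have hcos : ε * (sinPhase a ε x₀ u y - sinPhase a ε x₀ u x) = a * inner ℝ u (y - x) := by
    rw [sinPhase_sub]
    field_simp
  have hgrad : inner ℝ (sinQuadraticGrad a ε x₀ u x) (y - x) = a * inner ℝ (x - x₀) (y - x)
      - Real.cos (sinPhase a ε x₀ u x) * (a * inner ℝ u (y - x)) := by
    simp only [sinQuadraticGrad, inner_sub_left, real_inner_smul_left]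
    ring
  rw [hgrad, ← hcos]
  unfold sinQuadratic
  rw [hquad]
  linarith [mul_le_mul_of_nonneg_left hsin hε.le]

theorem norm_sinQuadraticGrad_sub_le {a ε L : ℝ} (hε : 0 < ε) (ha : 0 ≤ a) {u : E}
    (hu : a ^ 2 * ‖u‖ ^ 2 ≤ ε * (L - a)) (x₀ x y : E) :
    ‖sinQuadraticGrad a ε x₀ u x - sinQuadraticGrad a ε x₀ u y‖ ≤ L * ‖x - y‖ := by
  set c : ℝ := Real.cos (sinPhase a ε x₀ u x) - Real.cos (sinPhase a ε x₀ u y) with hc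
  have hcos : |c| ≤ a / ε * (‖u‖ * ‖x - y‖) := by
    calc |c| ≤ |sinPhase a ε x₀ u x - sinPhase a ε x₀ u y| := Real.abs_cos_sub_cos_le _ _
      _ = a / ε * |inner ℝ u (x - y)| := by
          rw [sinPhase_sub, abs_mul, abs_of_nonneg (by positivity)]
      _ ≤ a / ε * (‖u‖ * ‖x - y‖) := by
          gcongr
          exact abs_real_inner_le_norm _ _
  calc ‖sinQuadraticGrad a ε x₀ u x - sinQuadraticGrad a ε x₀ u y‖
      = ‖a • (x - y) - (a * c) • u‖ := by
        congr 1
        simp only [sinQuadraticGrad, hc]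
        module
    _ ≤ a * ‖x - y‖ + a * |c| * ‖u‖ := by
        refine (norm_sub_le _ _).trans_eq ?_
        rw [norm_smul, norm_smul, Real.norm_eq_abs, Real.norm_eq_abs, abs_mul, abs_of_nonneg ha]
    _ ≤ a * ‖x - y‖ + a * (a / ε * (‖u‖ * ‖x - y‖)) * ‖u‖ := by gcongr
    _ = (a + a ^ 2 * ‖u‖ ^ 2 / ε) * ‖x - y‖ := by ring
    _ ≤ L * ‖x - y‖ := by
        gcongr
        rw [← le_sub_iff_add_le']
        rwa [div_le_iff₀' hε]

theorem isMinOn_sinQuadratic {a ε τ : ℝ} (hτ : 0 ≤ τ) (hε : 0 < ε) {u : E}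
    (hu : a ^ 2 * ‖u‖ ^ 2 ≤ ε * (a - τ)) (x₀ : E) (B : Set E) :
    IsMinOn (sinQuadratic a ε x₀ u) B (x₀ + u) := by
  refine isMinOn_iff.2 fun y _ => ?_
  have := sinQuadratic_lower hε hu x₀ (x₀ + u) y
  rw [sinQuadraticGrad_add, inner_zero_left, add_zero] at this
  exact (le_add_of_nonneg_right (by positivity)).trans this

theorem isStronglyConvexSmooth_sinQuadratic {n : ℕ} {a ε τ L : ℝ} (hτ : 0 ≤ τ) (hε : 0 < ε)
    (ha : 0 ≤ a) {x₀ u : EuclideanSpace ℝ (Fin n)} {B : Set (EuclideanSpace ℝ (Fin n))}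
    (hB : x₀ + u ∈ B) (hτu : a ^ 2 * ‖u‖ ^ 2 ≤ ε * (a - τ)) (hLu : a ^ 2 * ‖u‖ ^ 2 ≤ ε * (L - a)) :
    IsStronglyConvexSmooth τ L B (sinQuadratic a ε x₀ u) :=
  ⟨sinQuadraticGrad a ε x₀ u,
    fun x _ => (hasGradientAt_sinQuadratic a hε.ne' x₀ u x).hasFDerivAt.hasFDerivWithinAt,
    fun x _ y _ => sinQuadratic_lower hε hτu x₀ x y,
    fun x _ y _ => norm_sinQuadraticGrad_sub_le hε ha hLu x₀ x y,
    x₀ + u, hB, isMinOn_sinQuadratic hτ hε hτu x₀ B⟩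

theorem abs_sinQuadratic_sub_le (a : ℝ) {ε : ℝ} (hε : 0 ≤ ε) (x₀ u x y : E) :
    |(sinQuadratic a ε x₀ u y - sinQuadratic a ε x₀ u x) -
      (a / 2 * ‖y - x₀‖ ^ 2 - a / 2 * ‖x - x₀‖ ^ 2)| ≤ 2 * ε := by
  have hsin : |Real.sin (sinPhase a ε x₀ u x) - Real.sin (sinPhase a ε x₀ u y)| ≤ 2 :=
    (norm_sub_le (Real.sin _) (Real.sin _)).trans
      ((add_le_add (Real.abs_sin_le_one _) (Real.abs_sin_le_one _)).trans_eq one_add_one_eq_two)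
  calc _ = |ε * (Real.sin (sinPhase a ε x₀ u x) - Real.sin (sinPhase a ε x₀ u y))| := by
        unfold sinQuadratic
        ring_nf
    _ ≤ 2 * ε := by
        rw [abs_mul, abs_of_nonneg hε, mul_comm 2]
        gcongr

end SinQuadratic

section RiskBounds

variable {n T : ℕ} {B : Set (EuclideanSpace ℝ (Fin n))} {x₀ : EuclideanSpace ℝ (Fin n)}
  {κ μ δ₀ τ L : ℝ}

theorem le_comparisonMinimaxRisk_of_two_pow_mul_le (s₀ : Bool) (hδ₀ : δ₀ ≤ 1 / 2) (hτ : 0 ≤ τ)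
    (hτL : τ ≤ L) {R δ : ℝ} (hR : 0 < R) (hball : Metric.ball x₀ R ⊆ B) (hδ : 0 < δ)
    (hT : 2 ^ T * (δ / R) ^ n ≤ 1 / 4) :
    ENNReal.ofReal (τ / 4 * δ ^ 2) ≤ comparisonMinimaxRisk s₀ κ μ δ₀ τ L B T := by
  refine le_comparisonMinimaxRisk_of_forall_mem_ball hτ hR hδ zero_le_two hball
    (Kernel.const _ fairCoin) (fun v hv => ?_) hT
  have hf : Measurable (sinQuadratic τ 1 v 0) := (continuous_sinQuadratic τ 1 v 0).measurable
  refine ⟨sinQuadratic τ 1 v 0, ?_, ?_, signOracle s₀ 1 hf,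
    isComparisonOracle_signOracle_one s₀ hδ₀ hf, fun z => ?_⟩
  · exact isStronglyConvexSmooth_sinQuadratic hτ one_pos hτ (by simpa using hball hv) (by simp)
      (by simpa using hτL)
  · simpa using isMinOn_sinQuadratic hτ one_pos (u := 0) (by simp) v B
  · simpa [signOracle_apply] using
      secondMomentBound_symmetricChannel 1 (boolSign s₀ (sinQuadratic τ 1 v 0 z.2 - _))

theorem exp_le_comparisonMinimaxRisk (s₀ : Bool) (hδ₀ : δ₀ ≤ 1 / 2) (hτ : 0 ≤ τ) (hτL : τ ≤ L)
    {r : ℝ} (hr : 0 < r) (hball : Metric.ball x₀ r ⊆ B) (hn : 0 < n) :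
    ENNReal.ofReal (τ * r ^ 2 / 64 * Real.exp (-(2 * Real.log 2) * ((T : ℝ) / n))) ≤
      comparisonMinimaxRisk s₀ κ μ δ₀ τ L B T := by
  let δ : ℝ := r / 4 * Real.exp (-(Real.log 2 * (T / n)))
  have hδn : 2 ^ T * (δ / r) ^ n = (1 / 4) ^ n := by
    have hscale : δ / r = 1 / 4 * Real.exp (-(Real.log 2 * (T / n))) := by
      simp only [δ]
      field_simp
    have hexp : Real.exp (-(Real.log 2 * (T / n))) ^ n = (2 ^ T)⁻¹ := by
      rw [← Real.exp_nat_mul, ← Real.exp_log (pow_pos two_pos T), ← Real.exp_neg, Real.log_pow]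
      congr 1
      field_simp
    rw [hscale, mul_pow, hexp, mul_comm, inv_mul_cancel_right₀ (by positivity)]
  have hδ_sq : τ / 4 * δ ^ 2 = τ * r ^ 2 / 64 * Real.exp (-(2 * Real.log 2) * (T / n)) := by
    rw [mul_pow, ← Real.exp_nat_mul]
    ring_nf
  rw [← hδ_sq]
  refine le_comparisonMinimaxRisk_of_two_pow_mul_le s₀ hδ₀ hτ hτL hr hball (by positivity) ?_
  rw [hδn]
  exact pow_le_of_le_one (by norm_num) (by norm_num) hn.ne'

theorem le_comparisonMinimaxRisk_of_one_add_pow_mul_le (s₀ : Bool) (hκ : 1 ≤ κ) (hμ : 0 ≤ μ)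
    (hδ₀ : δ₀ ≤ 1 / 2) (hτ : 0 ≤ τ) {a ε R δ : ℝ} (ha : 0 ≤ a) (hε : 0 < ε) (hR : 0 < R)
    (hτR : a ^ 2 * R ^ 2 ≤ ε * (a - τ)) (hLR : a ^ 2 * R ^ 2 ≤ ε * (L - a))
    (hball : Metric.ball x₀ R ⊆ B) (hδ : 0 < δ)
    (hT : (1 + 4 * (μ * (4 * ε) ^ (κ - 1)) ^ 2) ^ T * (δ / R) ^ n ≤ 1 / 4) :
    ENNReal.ofReal (τ / 4 * δ ^ 2) ≤ comparisonMinimaxRisk s₀ κ μ δ₀ τ L B T := by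
  have hq : Measurable fun x : EuclideanSpace ℝ (Fin n) => a / 2 * ‖x - x₀‖ ^ 2 := by fun_prop
  obtain ⟨Q, _, hQ⟩ :=
    exists_referenceOracle (B := B) s₀ hκ hμ hδ₀ (mul_nonneg zero_le_two hε.le) hq
  rw [show 4 * ε = 2 * (2 * ε) by ring] at hT
  refine le_comparisonMinimaxRisk_of_forall_mem_ball hτ hR hδ (by positivity) hball Q
    (fun v hv => ?_) hT
  obtain ⟨u, rfl⟩ : ∃ u, v = x₀ + u := ⟨v - x₀, (add_sub_cancel _ _).symm⟩
  have huR : a ^ 2 * ‖u‖ ^ 2 ≤ a ^ 2 * R ^ 2 := by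
    gcongr
    exact (by simpa using hv : ‖u‖ < R).le
  exact ⟨sinQuadratic a ε x₀ u,
    isStronglyConvexSmooth_sinQuadratic hτ hε ha (hball hv) (huR.trans hτR) (huR.trans hLR),
    isMinOn_sinQuadratic hτ hε (huR.trans hτR) x₀ B,
    hQ _ (continuous_sinQuadratic a ε x₀ u).measurable
      fun x y => abs_sinQuadratic_sub_le a hε.le x₀ u x y⟩

theorem one_add_div_pow_le_exp_one_pow (n T : ℕ) : (1 + (n : ℝ) / T) ^ T ≤ Real.exp 1 ^ n := by
  rcases T.eq_zero_or_pos with rfl | hT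
  · simp
  calc (1 + (n : ℝ) / T) ^ T ≤ Real.exp (n / T) ^ T := by
        gcongr
        simpa only [add_comm] using Real.add_one_le_exp ((n : ℝ) / T)
    _ = Real.exp 1 ^ n := by
        rw [← Real.exp_nat_mul, ← Real.exp_nat_mul, mul_one, mul_div_cancel₀ _ (by positivity)]

theorem mul_le_comparisonMinimaxRisk_of_noise_le (s₀ : Bool) (hκ : 1 ≤ κ) (hμ : 0 ≤ μ)
    (hδ₀ : δ₀ ≤ 1 / 2) (hτ : 0 ≤ τ) (hτL : τ < L) (hn : 0 < n) {ε r : ℝ} (hε : 0 < ε)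
    (hr : 0 ≤ r) (hball : Metric.ball x₀ r ⊆ B)
    (hεr : 2 * (L - τ) / (τ + L) ^ 2 * ε ≤ r ^ 2)
    (hεT : 4 * (μ * (4 * ε) ^ (κ - 1)) ^ 2 ≤ n / T) :
    ENNReal.ofReal (τ * (L - τ) / (512 * (τ + L) ^ 2) * ε) ≤
      comparisonMinimaxRisk s₀ κ μ δ₀ τ L B T := by
  have hL : 0 < L - τ := sub_pos.2 hτL
  have hsum : 0 < τ + L := by linarith
  let R : ℝ := √(2 * (L - τ) / (τ + L) ^ 2 * ε)
  have hR : 0 < R := Real.sqrt_pos.2 (by positivity)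
  have hR_sq : R ^ 2 = 2 * (L - τ) / (τ + L) ^ 2 * ε := Real.sq_sqrt (by positivity)
  have hRr : R ≤ r := Real.sqrt_le_iff.2 ⟨hr, hεr⟩
  have haR : ((τ + L) / 2) ^ 2 * R ^ 2 = ε * ((L - τ) / 2) := by
    rw [hR_sq]
    field_simp
  have hpow : (1 + 4 * (μ * (4 * ε) ^ (κ - 1)) ^ 2) ^ T * (R / 16 / R) ^ n ≤ 1 / 4 := by
    calc _ ≤ (1 + (n : ℝ) / T) ^ T * (1 / 16) ^ n := by
          rw [div_right_comm, div_self hR.ne']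
          gcongr
      _ ≤ 4 ^ n * (1 / 16) ^ n := by
          have hexp : Real.exp 1 ≤ 4 := by linarith [Real.exp_one_lt_d9]
          gcongr
          exact (one_add_div_pow_le_exp_one_pow n T).trans (by gcongr)
      _ = (1 / 4) ^ n := by rw [← mul_pow]; norm_num
      _ ≤ 1 / 4 := pow_le_of_le_one (by norm_num) (by norm_num) hn.ne'
  have hδ_sq : τ / 4 * (R / 16) ^ 2 = τ * (L - τ) / (512 * (τ + L) ^ 2) * ε := by
    rw [div_pow, hR_sq]
    field_simp
    ring
  rw [← hδ_sq]
  exact le_comparisonMinimaxRisk_of_one_add_pow_mul_le s₀ hκ hμ hδ₀ hτ (a := (τ + L) / 2)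
    (by positivity) hε hR (haR.trans_le (by gcongr; linarith)) (haR.trans_le (by gcongr; linarith))
    ((Metric.ball_subset_ball hRr).trans hball) (by positivity) hpow

theorem four_mul_sq_mul_rpow_rpow (hκ : 1 < κ) (hμ : 0 < μ) {t : ℝ} (ht : 0 ≤ t) :
    4 * (μ * ((t / (4 * μ ^ 2)) ^ (1 / (2 * (κ - 1)))) ^ (κ - 1)) ^ 2 = t := by
  have hκ' : κ - 1 ≠ 0 := (sub_pos.2 hκ).ne'
  have hexp : 1 / (2 * (κ - 1)) * (κ - 1) = 1 / 2 := by field_simp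
  rw [← Real.rpow_mul (by positivity), hexp, ← Real.sqrt_eq_rpow, mul_pow,
    Real.sq_sqrt (by positivity)]
  field_simp

theorem exists_mul_rpow_le_comparisonMinimaxRisk (s₀ : Bool) (hκ : 1 < κ) (hμ : 0 < μ)
    (hδ₀ : δ₀ ≤ 1 / 2) (hτ : 0 < τ) (hτL : τ < L) {r : ℝ} (hr : 0 < r) :
    ∃ c : ℝ, 0 < c ∧ ∀ n : ℕ, 0 < n → ∀ B : Set (EuclideanSpace ℝ (Fin n)),
      (∃ x₀, Metric.ball x₀ r ⊆ B) → ∀ᶠ T : ℕ in Filter.atTop,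
        ENNReal.ofReal (c * ((n : ℝ) / T) ^ (1 / (2 * (κ - 1)))) ≤
          comparisonMinimaxRisk s₀ κ μ δ₀ τ L B T := by
  have : 0 < L - τ := sub_pos.2 hτL
  have hsum : 0 < τ + L := by linarith
  have hp : 0 < 1 / (2 * (κ - 1)) := by
    have := sub_pos.2 hκ
    positivity
  set p : ℝ := 1 / (2 * (κ - 1)) with hp_def
  refine ⟨τ * (L - τ) / (512 * (τ + L) ^ 2) * (((4 * μ ^ 2) ^ p)⁻¹ / 4), by positivity, ?_⟩
  rintro n hn B ⟨x₀, hball⟩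
  let ε (T : ℕ) : ℝ := ((n : ℝ) / T / (4 * μ ^ 2)) ^ p / 4
  have hε_tendsto : Filter.Tendsto (fun T => 2 * (L - τ) / (τ + L) ^ 2 * ε T) Filter.atTop
      (nhds 0) := by
    have := ((tendsto_const_div_atTop_nhds_zero_nat (n : ℝ)).div_const (4 * μ ^ 2)).rpow_const
      (Or.inr hp.le)
    simpa [hp.ne'] using (this.div_const 4).const_mul (2 * (L - τ) / (τ + L) ^ 2)
  filter_upwards [hε_tendsto.eventually_le_const (pow_pos hr 2), Filter.eventually_gt_atTop 0]
    with T hεr hT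
  have hε : 0 < ε T := by positivity
  have hεT : 4 * (μ * (4 * ε T) ^ (κ - 1)) ^ 2 = n / T := by
    rw [mul_div_cancel₀ _ (by norm_num : (4 : ℝ) ≠ 0), hp_def,
      four_mul_sq_mul_rpow_rpow hκ hμ (by positivity)]
  have hε_eq : ((4 * μ ^ 2) ^ p)⁻¹ / 4 * ((n : ℝ) / T) ^ p = ε T := by
    simp only [ε]
    rw [Real.div_rpow (by positivity : 0 ≤ (n : ℝ) / T) (by positivity)]
    ring
  rw [mul_assoc, hε_eq]
  exact mul_le_comparisonMinimaxRisk_of_noise_le s₀ hκ.le hμ.le hδ₀ hτ.le hτL hn hε hr.le hball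
    hεr hεT.le

end RiskBounds

end

theorem theorem1_general (s₀ : Bool) (κ μ δ₀ τ L r : ℝ) (hδ₀ : δ₀ ≤ 1 / 2)
    (hτ : 0 < τ) (hτL : τ ≤ L) (hr : 0 < r) :
    (∃ c₁ c₂ : ℝ, 0 < c₁ ∧ 0 < c₂ ∧
      ∀ n : ℕ, 0 < n → ∀ B : Set (EuclideanSpace ℝ (Fin n)), (∃ x₀, Metric.ball x₀ r ⊆ B) →
        ∀ T : ℕ, ENNReal.ofReal (c₁ * Real.exp (-c₂ * ((T : ℝ) / n))) ≤
          comparisonMinimaxRisk s₀ κ μ δ₀ τ L B T) ∧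
    (1 < κ → 0 < μ → τ < L → ∃ c₃ : ℝ, 0 < c₃ ∧
      ∀ n : ℕ, 0 < n → ∀ B : Set (EuclideanSpace ℝ (Fin n)), (∃ x₀, Metric.ball x₀ r ⊆ B) →
        ∃ T₀ : ℕ, ∀ T : ℕ, T₀ ≤ T →
          ENNReal.ofReal (c₃ * ((n : ℝ) / T) ^ (1 / (2 * (κ - 1)))) ≤
            comparisonMinimaxRisk s₀ κ μ δ₀ τ L B T) := by
  refine ⟨⟨τ * r ^ 2 / 64, 2 * Real.log 2, by positivity, by positivity, ?_⟩, ?_⟩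
  · rintro n hn B ⟨x₀, hball⟩ T
    exact exp_le_comparisonMinimaxRisk s₀ hδ₀ hτ.le hτL hr hball hn
  · intro hκ hμ hτL
    simpa only [Filter.eventually_atTop] using
      exists_mul_rpow_le_comparisonMinimaxRisk s₀ hκ hμ hδ₀ hτ hτL hr

theorem theorem1 (s₀ : Bool) (κ μ δ₀ τ L r : ℝ)
    (hκ : 1 ≤ κ) (hμ : 0 < μ) (hδ₀ : 0 < δ₀) (hδ₀' : δ₀ ≤ 1 / 2)
    (hτ : 0 < τ) (hτL : τ ≤ L) (hr : 0 < r) :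
    (κ = 1 → ∃ c₁ c₂ : ℝ, 0 < c₁ ∧ 0 < c₂ ∧
      ∀ n : ℕ, 8 ≤ n → ∀ B : Set (EuclideanSpace ℝ (Fin n)), Convex ℝ B →
        (∃ x₀, Metric.ball x₀ r ⊆ B) →
        ∃ T₀ : ℕ, ∀ T : ℕ, T₀ ≤ T →
          ENNReal.ofReal (c₁ * Real.exp (-c₂ * ((T : ℝ) / n))) ≤
            comparisonMinimaxRisk s₀ κ μ δ₀ τ L B T) ∧
    (1 < κ → τ < L → ∃ c₃ : ℝ, 0 < c₃ ∧
      ∀ n : ℕ, 8 ≤ n → ∀ B : Set (EuclideanSpace ℝ (Fin n)), Convex ℝ B →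
        (∃ x₀, Metric.ball x₀ r ⊆ B) →
        ∃ T₀ : ℕ, ∀ T : ℕ, T₀ ≤ T →
          ENNReal.ofReal (c₃ * ((n : ℝ) / T) ^ (1 / (2 * (κ - 1)))) ≤
            comparisonMinimaxRisk s₀ κ μ δ₀ τ L B T) := by
  obtain ⟨⟨c₁, c₂, hc₁, hc₂, hexp⟩, hpoly⟩ := theorem1_general s₀ κ μ δ₀ τ L r hδ₀' hτ hτL hr
  refine ⟨fun _ => ⟨c₁, c₂, hc₁, hc₂, fun n hn B _ hB => ⟨0, fun T _ => ?_⟩⟩, fun hκ hτL => ?_⟩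
  · exact hexp n (by lia) B hB T
  · obtain ⟨c₃, hc₃, h⟩ := hpoly hκ hμ hτL
    exact ⟨c₃, hc₃, fun n hn B _ hB => h n (by lia) B hB⟩
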